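/- Let $X$ be a separable (real) Banach lattice with positive cone $X^+=\{x\in X: x\ge 0\}$. A point $u\in X^+$ is called a support point of $X^+$ if there is a nonzero continuous linear functional $x^*$ on $X$ with $\langle x^*,u\rangle=\max\{\langle x^*,y\rangle: y\in X^+\}$, and a nonsupport point of $X^+$ otherwise; $(X^+)_N$ denotes the set of nonsupport points of $X^+$. For $u\in X^+$ put $C_u=\bigcup_{\lambda>0}\lambda(X^+-u)$, and let $X_u=C_u\cap(-C_u)$ be the generating space of $X^+$ at $u$, a linear subspace of $X$, with the order inherited from $X$ and the norm $$\|x\|_u=\inf\{\lambda>0: -\lambda u\le x\le\lambda u\}.$$ Then: (i) $(X^+)_N\neq\emptyset$; (ii) for every $u\in(X^+)_N$, the space $(X_u,\|\cdot\|_u)$ is a Banach lattice with unit $u$ (that is, $u\in X_u$, $u\ge0$, every $x\in X_u$ satisfies $|x|\le\lambda u$ for some $\lambda>0$, and the closed unit ball of $X_u$ is the order interval $[-u,u]$), and it is order isometric to $C(K)$, the real-valued continuous functions on $K$ with the supremum norm and the pointwise order, for some compact Hausdorff space $K$; that is, there is a linear isometry $T$ of $X_u$ onto $C(K)$ such that $Tx\ge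 Ty$ if and only if $x\ge y$. -/

import Mathlib

universe v

/-- Banach lattices: complete normed real vector lattices whose order is compatible with the
linear structure and whose norm satisfies `‖x‖ ≤ ‖y‖` whenever `|x| ≤ |y|`. -/
class IsBanachLattice (E : Type*) [NormedAddCommGroup E] [NormedSpace ℝ E] [Lattice E] : Prop
    extends IsOrderedAddMonoid E, IsOrderedModule ℝ E, HasSolidNorm E, CompleteSpace E

section Convex

variable {X : Type v} [NormedAddCommGroup X] [NormedSpace ℝ X]

/-- `x` is a support point of `C`: `x ∈ C`, and some nonzero continuous linear functional attains
its maximum over `C` at `x`. -/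
def IsSupportPoint (C : Set X) (x : X) : Prop :=
  x ∈ C ∧ ∃ f : X →L[ℝ] ℝ, f ≠ 0 ∧ ∀ y ∈ C, f y ≤ f x

/-- The set `C_N` of all nonsupport points of `C`. -/
def nonsupportPoints (C : Set X) : Set X := C \ {x | IsSupportPoint C x}

/-- The cone `C_x = ⋃_{r > 0} r (C - x)`. -/
def generatedCone (C : Set X) (x : X) : Set X :=
  {z | ∃ r : ℝ, 0 < r ∧ ∃ c ∈ C, z = r • (c - x)}

theorem generatedCone_add {C : Set X} (hC : Convex ℝ C) {x a b : X}
    (ha : a ∈ generatedCone C x) (hb : b ∈ generatedCone C x) : a + b ∈ generatedCone C x := by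
  obtain ⟨r, hr, c, hc, rfl⟩ := ha
  obtain ⟨s, hs, d, hd, rfl⟩ := hb
  have hrs : 0 < r + s := add_pos hr hs
  refine ⟨r + s, hrs, (r / (r + s)) • c + (s / (r + s)) • d,
    hC hc hd (by positivity) (by positivity) (by field_simp), ?_⟩
  rw [smul_sub (r + s), smul_add, smul_smul, smul_smul, mul_div_cancel₀ _ hrs.ne',
    mul_div_cancel₀ _ hrs.ne', add_smul, smul_sub, smul_sub]
  abel

theorem generatedCone_smul {C : Set X} {x a : X} {t : ℝ} (ht : 0 < t)
    (ha : a ∈ generatedCone C x) : t • a ∈ generatedCone C x := by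
  obtain ⟨r, hr, c, hc, rfl⟩ := ha
  exact ⟨t * r, mul_pos ht hr, c, hc, by rw [smul_smul]⟩

theorem zero_mem_generatedCone {C : Set X} {x : X} (hx : x ∈ C) : 0 ∈ generatedCone C x :=
  ⟨1, one_pos, x, hx, by simp⟩

/-- The `(C, x)`-generating space `C_x ∩ (-C_x)`, a linear subspace of `X`. -/
def generatingSubspace (C : Set X) (hC : Convex ℝ C) (x : X) (hx : x ∈ C) : Submodule ℝ X where
  carrier := {z | z ∈ generatedCone C x ∧ -z ∈ generatedCone C x}
  zero_mem' := ⟨zero_mem_generatedCone hx, by simpa using zero_mem_generatedCone hx⟩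
  add_mem' := by
    rintro a b ⟨ha, ha'⟩ ⟨hb, hb'⟩
    exact ⟨generatedCone_add hC ha hb, by
      rw [neg_add]; exact generatedCone_add hC ha' hb'⟩
  smul_mem' := by
    rintro t a ⟨ha, ha'⟩
    rcases lt_trichotomy t 0 with ht | rfl | ht
    · have ht' : 0 < -t := neg_pos.2 ht
      exact ⟨by simpa using generatedCone_smul ht' ha',
        by simpa using generatedCone_smul ht' ha⟩
    · simpa using zero_mem_generatedCone hx
    · exact ⟨generatedCone_smul ht ha, by simpa using generatedCone_smul ht ha'⟩

end Convex

section Lattice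

variable {X : Type v} [NormedAddCommGroup X] [NormedSpace ℝ X] [Lattice X] [IsBanachLattice X]

/-- The positive cone `X⁺`. -/
def positiveCone (X : Type v) [NormedAddCommGroup X] [Lattice X] : Set X := {x | 0 ≤ x}

theorem convex_positiveCone : Convex ℝ (positiveCone X) := convex_Ici (𝕜 := ℝ) (0 : X)

/-- The generating space `X_u = C_u ∩ (-C_u)` of the positive cone `C = X⁺` at `u ∈ X⁺`. This is a
type of its own, so that it carries the norm `‖·‖_u` below and not the norm of `X`. -/
def GeneratingSpace (u : X) (hu : u ∈ positiveCone X) : Type v :=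
  ↥(generatingSubspace (positiveCone X) convex_positiveCone u hu)

namespace GeneratingSpace

theorem mem_iff {u : X} (hu : u ∈ positiveCone X) (z : X) :
    z ∈ generatingSubspace (positiveCone X) convex_positiveCone u hu ↔
      ∃ r : ℝ, 0 < r ∧ -(r • u) ≤ z ∧ z ≤ r • u := by
  have h0 : (0 : X) ≤ u := hu
  constructor
  · rintro ⟨⟨r, hr, c, hc, h1⟩, ⟨s, hs, d, hd, h2⟩⟩
    have hc' : (0 : X) ≤ c := hc
    have hd' : (0 : X) ≤ d := hd
    refine ⟨r + s, add_pos hr hs, ?_, ?_⟩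
    · rw [h1, smul_sub, add_smul, neg_le_iff_add_nonneg]
      have e : r • c - r • u + (r • u + s • u) = r • c + s • u := by abel
      rw [e]
      exact add_nonneg (smul_nonneg hr.le hc') (smul_nonneg hs.le h0)
    · have h3 : z = -(s • (d - u)) := by rw [← h2, neg_neg]
      rw [h3, smul_sub, add_smul, neg_le_iff_add_nonneg]
      have e : r • u + s • u + (s • d - s • u) = r • u + s • d := by abel
      rw [e]
      exact add_nonneg (smul_nonneg hr.le h0) (smul_nonneg hs.le hd')
  · have key : ∀ (y : X) (r : ℝ), 0 < r → -(r • u) ≤ y → y ∈ generatedCone (positiveCone X) u := by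
      intro y r hr hy
      refine ⟨r, hr, r⁻¹ • y + u, ?_, ?_⟩
      · have h : (0 : X) ≤ r⁻¹ • (y + r • u) :=
          smul_nonneg (inv_nonneg.2 hr.le) (neg_le_iff_add_nonneg.1 hy)
        rw [smul_add, smul_smul, inv_mul_cancel₀ hr.ne', one_smul] at h
        exact h
      · rw [add_sub_cancel_right, smul_smul, mul_inv_cancel₀ hr.ne', one_smul]
    rintro ⟨r, hr, h1, h2⟩
    exact ⟨key z r hr h1, key (-z) r hr (neg_le_neg h2)⟩

theorem bound_mono {u : X} (hu : u ∈ positiveCone X) {r s : ℝ} (hrs : r ≤ s) {z : X}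
    (h : -(r • u) ≤ z ∧ z ≤ r • u) : -(s • u) ≤ z ∧ z ≤ s • u := by
  have h1 : r • u ≤ s • u := smul_le_smul_of_nonneg_right hrs hu
  exact ⟨(neg_le_neg h1).trans h.1, h.2.trans h1⟩

variable {u : X} {hu : u ∈ positiveCone X}

instance : AddCommGroup (GeneratingSpace u hu) :=
  inferInstanceAs (AddCommGroup ↥(generatingSubspace (positiveCone X) convex_positiveCone u hu))

instance : Module ℝ (GeneratingSpace u hu) :=
  inferInstanceAs (Module ℝ ↥(generatingSubspace (positiveCone X) convex_positiveCone u hu))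

/-- The inclusion of `X_u` in `X`. -/
def incl (u : X) (hu : u ∈ positiveCone X) : GeneratingSpace u hu →ₗ[ℝ] X :=
  (generatingSubspace (positiveCone X) convex_positiveCone u hu).subtype

/-- The order of `X_u` is the restriction of the order of `X`; it is a lattice order, with the
lattice operations of `X`. -/
instance : Lattice (GeneratingSpace u hu) :=
  Subtype.lattice
    (P := fun z => z ∈ generatingSubspace (positiveCone X) convex_positiveCone u hu)
    (by
      intro x y hx hy
      rw [mem_iff] at hx hy ⊢
      obtain ⟨r, hr, h1⟩ := hx
      obtain ⟨s, hs, h2⟩ := hy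
      have h1' := bound_mono hu (le_max_left r s) h1
      have h2' := bound_mono hu (le_max_right r s) h2
      exact ⟨max r s, lt_max_of_lt_left hr, h1'.1.trans le_sup_left, sup_le h1'.2 h2'.2⟩)
    (by
      intro x y hx hy
      rw [mem_iff] at hx hy ⊢
      obtain ⟨r, hr, h1⟩ := hx
      obtain ⟨s, hs, h2⟩ := hy
      have h1' := bound_mono hu (le_max_left r s) h1
      have h2' := bound_mono hu (le_max_right r s) h2
      exact ⟨max r s, lt_max_of_lt_left hr, le_inf h1'.1 h2'.1, inf_le_left.trans h1'.2⟩)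

theorem incl_le_incl {x y : GeneratingSpace u hu} : incl u hu x ≤ incl u hu y ↔ x ≤ y := Iff.rfl

theorem incl_injective : Function.Injective (incl u hu) := Subtype.val_injective

/-- The set of all `r > 0` with `-r u ≤ x ≤ r u`. -/
def bounds (x : GeneratingSpace u hu) : Set ℝ :=
  {r | 0 < r ∧ -(r • u) ≤ incl u hu x ∧ incl u hu x ≤ r • u}

theorem bounds_nonempty (x : GeneratingSpace u hu) : (bounds x).Nonempty := (mem_iff hu x.1).1 x.2

theorem bounds_bddBelow (x : GeneratingSpace u hu) : BddBelow (bounds x) := ⟨0, fun _ h => h.1.le⟩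

/-- The value `‖x‖_u = inf {r > 0 : -r u ≤ x ≤ r u}`. -/
noncomputable def unorm (x : GeneratingSpace u hu) : ℝ := sInf (bounds x)

theorem unorm_le_of_mem {x : GeneratingSpace u hu} {r : ℝ} (h : r ∈ bounds x) : unorm x ≤ r :=
  csInf_le (bounds_bddBelow x) h

theorem mem_of_unorm_lt {x : GeneratingSpace u hu} {r : ℝ} (h : unorm x < r) : r ∈ bounds x := by
  obtain ⟨s, hs, hsr⟩ := exists_lt_of_csInf_lt (bounds_nonempty x) h
  exact ⟨hs.1.trans hsr, bound_mono hu hsr.le hs.2⟩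

theorem unorm_nonneg (x : GeneratingSpace u hu) : 0 ≤ unorm x :=
  le_csInf (bounds_nonempty x) fun _ h => h.1.le

theorem unorm_smul_le (t : ℝ) (x : GeneratingSpace u hu) : unorm (t • x) ≤ |t| * unorm x := by
  refine le_of_forall_pos_le_add fun ε hε => ?_
  have hd : 0 < |t| + 1 := by positivity
  have hlt : unorm x < unorm x + ε / (|t| + 1) := lt_add_of_pos_right _ (by positivity)
  set r := unorm x + ε / (|t| + 1) with hr
  obtain ⟨hr0, h1, h2⟩ := mem_of_unorm_lt hlt
  have hle : |t| * r ≤ |t| * unorm x + ε := by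
    rw [hr, mul_add]
    have : |t| * (ε / (|t| + 1)) ≤ ε := by
      rw [mul_div_assoc', div_le_iff₀ hd]
      nlinarith
    linarith
  have hpos : 0 < |t| * unorm x + ε := by
    have := mul_nonneg (abs_nonneg t) (unorm_nonneg x)
    linarith
  refine unorm_le_of_mem ⟨hpos, bound_mono hu hle ?_⟩
  rw [map_smul]
  rcases le_total 0 t with ht | ht
  · rw [abs_of_nonneg ht, mul_smul, ← smul_neg]
    exact ⟨smul_le_smul_of_nonneg_left h1 ht, smul_le_smul_of_nonneg_left h2 ht⟩
  · rw [abs_of_nonpos ht, mul_smul, neg_smul, neg_neg]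
    have ht' : 0 ≤ -t := neg_nonneg.2 ht
    have h3 := smul_le_smul_of_nonneg_left h1 ht'
    have h4 := smul_le_smul_of_nonneg_left h2 ht'
    rw [neg_smul, neg_smul] at h3 h4
    rw [smul_neg, neg_neg] at h3
    exact ⟨by simpa using neg_le_neg h4, by simpa using neg_le_neg h3⟩

theorem unorm_add_le (x y : GeneratingSpace u hu) : unorm (x + y) ≤ unorm x + unorm y := by
  refine le_of_forall_pos_le_add fun ε hε => ?_
  obtain ⟨hr, h1, h2⟩ := mem_of_unorm_lt (x := x) (r := unorm x + ε / 2) (by linarith)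
  obtain ⟨hs, h3, h4⟩ := mem_of_unorm_lt (x := y) (r := unorm y + ε / 2) (by linarith)
  have e : unorm x + unorm y + ε = (unorm x + ε / 2) + (unorm y + ε / 2) := by ring
  rw [e]
  refine unorm_le_of_mem ⟨add_pos hr hs, ?_, ?_⟩
  · rw [map_add, add_smul, neg_add]
    exact add_le_add h1 h3
  · rw [map_add, add_smul]
    exact add_le_add h2 h4

theorem eq_zero_of_unorm_eq_zero (x : GeneratingSpace u hu) (hx : unorm x = 0) : x = 0 := by
  apply incl_injective
  rw [map_zero]
  have hb : ∀ r : ℝ, 0 < r → ‖incl u hu x‖ ≤ r * ‖u‖ := by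
    intro r hr
    obtain ⟨-, h1, h2⟩ := mem_of_unorm_lt (x := x) (r := r) (by rw [hx]; exact hr)
    have h0 : (0 : X) ≤ r • u := smul_nonneg hr.le hu
    have h3 : |incl u hu x| ≤ |r • u| := by
      rw [abs_of_nonneg h0]
      exact abs_le'.2 ⟨h2, neg_le.1 h1⟩
    have h4 := norm_le_norm_of_abs_le_abs h3
    rwa [norm_smul, Real.norm_of_nonneg hr.le] at h4
  rw [← norm_le_zero_iff]
  refine le_of_forall_pos_le_add fun ε hε => ?_
  have hd : 0 < ‖u‖ + 1 := by positivity
  refine (hb (ε / (‖u‖ + 1)) (by positivity)).trans ?_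
  rw [zero_add, div_mul_eq_mul_div, div_le_iff₀ hd]
  nlinarith

/-- `X_u` is normed by `‖x‖_u`. -/
noncomputable instance : NormedAddCommGroup (GeneratingSpace u hu) :=
  AddGroupNorm.toNormedAddCommGroup
    { toFun := unorm
      map_zero' := le_antisymm
        (by simpa using unorm_smul_le (0 : ℝ) (0 : GeneratingSpace u hu)) (unorm_nonneg _)
      add_le' := unorm_add_le
      neg' := by
        have h : ∀ x : GeneratingSpace u hu, unorm (-x) ≤ unorm x := fun x => by
          simpa using unorm_smul_le (-1 : ℝ) x
        intro x
        exact le_antisymm (h x) (by simpa using h (-x))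
      eq_zero_of_map_eq_zero' := eq_zero_of_unorm_eq_zero }

theorem norm_def (x : GeneratingSpace u hu) :
    ‖x‖ = sInf {r : ℝ | 0 < r ∧ -(r • u) ≤ incl u hu x ∧ incl u hu x ≤ r • u} := rfl

noncomputable instance : NormedSpace ℝ (GeneratingSpace u hu) where
  norm_smul_le := unorm_smul_le

/-- The point `u`, as an element of `X_u`. -/
def unit (u : X) (hu : u ∈ positiveCone X) : GeneratingSpace u hu :=
  ⟨u, (mem_iff hu u).2 ⟨1, one_pos, by
    have h0 : (0 : X) ≤ u := hu
    rw [one_smul]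
    exact ⟨(neg_nonpos.2 h0).trans h0, le_rfl⟩⟩⟩

end GeneratingSpace

end Lattice

/-- `e` is a unit of the normed vector lattice `E`: a positive element whose multiples dominate
every element of `E`, and such that the closed unit ball of `E` is the order interval `[-e, e]`. -/
structure IsLatticeUnit {E : Type*} [NormedAddCommGroup E] [NormedSpace ℝ E] [Lattice E]
    (e : E) : Prop where
  nonneg : 0 ≤ e
  dominates : ∀ x : E, ∃ r : ℝ, 0 < r ∧ |x| ≤ r • e
  closedBall_eq : Metric.closedBall (0 : E) 1 = Set.Icc (-e) e

/-- `E` and `F` are order isometric: there is a linear isometry of `E` onto `F` that preserves the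
order in both directions. -/
def OrderIsometric (E F : Type*) [NormedAddCommGroup E] [NormedSpace ℝ E] [PartialOrder E]
    [NormedAddCommGroup F] [NormedSpace ℝ F] [PartialOrder F] : Prop :=
  ∃ T : E ≃ₗᵢ[ℝ] F, ∀ x y : E, T x ≤ T y ↔ x ≤ y

/-! ### Existence of nonsupport points -/

section NonsupportPoints

variable {X : Type v} [NormedAddCommGroup X] [NormedSpace ℝ X] [Lattice X] [IsBanachLattice X]

/-! For (i), a functional supporting the cone at `u` is nonpositive on the cone and zero at `u`,
hence zero on the order ideal generated by `u`. A weighted sum of the moduli of a dense sequence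
generates a dense ideal, so only the zero functional supports the cone there
(`exists_nonneg_dominating_sequence`).

For (ii), `X_u` is that ideal with the gauge norm of `[-u, u]`. It is complete because its inclusion
in `X` is continuous and order intervals are closed in `X`, and its unit ball is `[-u, u]`.

The rest is Kakutani's theorem. `K` is the weak-* compact set of states that are lattice
homomorphisms, and `E` acts on it by evaluation. Hahn-Banach shows that extreme states lie in `K`
(`apply_posPart_of_mem_extremePoints`), Krein-Milman on a face of norming states makes evaluation
isometric (`norm_latticeEval`), and the lattice form of Stone-Weierstrass makes it onto
(`latticeEval_surjective`). -/

/-- A functional that attains its maximum over the positive cone is nonpositive there, and its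
maximum is zero. -/
theorem eq_zero_and_nonpos_of_isMax_positiveCone {f : X →L[ℝ] ℝ} {u : X} (hu : 0 ≤ u)
    (hf : ∀ y ∈ positiveCone X, f y ≤ f u) : f u = 0 ∧ ∀ y, 0 ≤ y → f y ≤ 0 := by
  have h1 : f u ≤ 0 := by
    have := hf ((2 : ℝ) • u) (smul_nonneg zero_le_two hu)
    rw [map_smul, smul_eq_mul] at this
    linarith
  have h2 : 0 ≤ f u := by simpa using hf 0 le_rfl
  exact ⟨le_antisymm h1 h2, fun y hy => (hf y hy).trans h1⟩

/-- For each sequence in a Banach lattice there is a positive element such that the modulus of each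
term is dominated by some positive multiple of it. -/
theorem exists_nonneg_dominating_sequence (d : ℕ → X) :
    ∃ u : X, 0 ≤ u ∧ ∀ n, ∃ r : ℝ, 0 < r ∧ |d n| ≤ r • u := by
  have hc : ∀ n, 0 < (1 / 2 : ℝ) ^ n / (1 + ‖d n‖) := fun n => by positivity
  -- The weights bound the norm of the `n`-th term by `2⁻ⁿ`; the `1 +` keeps them positive when `d n
  -- = 0`.
  set w : ℕ → X := fun n => ((1 / 2 : ℝ) ^ n / (1 + ‖d n‖)) • |d n| with hw
  have hw0 : ∀ n, 0 ≤ w n := fun n => smul_nonneg (hc n).le (abs_nonneg _)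
  have hs : Summable w := by
    refine Summable.of_norm_bounded summable_geometric_two fun n => ?_
    rw [hw, norm_smul, Real.norm_of_nonneg (hc n).le, norm_abs_eq_norm, div_mul_eq_mul_div,
      div_le_iff₀ (by positivity)]
    exact mul_le_mul_of_nonneg_left (by linarith) (by positivity)
  refine ⟨∑' n, w n, tsum_nonneg hw0, fun n => ⟨_, inv_pos.2 (hc n), ?_⟩⟩
  have h := smul_le_smul_of_nonneg_left (hs.le_tsum n fun m _ => hw0 m) (inv_pos.2 (hc n)).le
  rwa [hw, smul_smul, inv_mul_cancel₀ (hc n).ne', one_smul] at h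

theorem nonsupportPoints_positiveCone_nonempty [TopologicalSpace.SeparableSpace X] :
    (nonsupportPoints (positiveCone X)).Nonempty := by
  obtain ⟨u, hu, hdom⟩ := exists_nonneg_dominating_sequence (TopologicalSpace.denseSeq X)
  refine ⟨u, hu, fun ⟨_, f, hf0, hf⟩ => hf0 ?_⟩
  obtain ⟨hfu, hneg⟩ := eq_zero_and_nonpos_of_isMax_positiveCone hu hf
  have hzero : ∀ n y, 0 ≤ y → y ≤ |TopologicalSpace.denseSeq X n| → f y = 0 := by
    intro n y hy hyd
    obtain ⟨r, -, h⟩ := hdom n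
    -- Both `y` and `r • u - y` are positive, and `f` takes opposite values on them because `f u =
    -- 0`.
    have h1 := hneg (r • u - y) (sub_nonneg.2 (hyd.trans h))
    rw [map_sub, map_smul, hfu, smul_zero, zero_sub] at h1
    exact le_antisymm (hneg y hy) (by linarith)
  have heq : (f : X → ℝ) = (0 : X →L[ℝ] ℝ) := by
    refine (TopologicalSpace.denseRange_denseSeq X).equalizer f.continuous
      (0 : X →L[ℝ] ℝ).continuous (funext fun n => ?_)
    have h := posPart_sub_negPart (TopologicalSpace.denseSeq X n)
    have h' := posPart_add_negPart (TopologicalSpace.denseSeq X n)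
    simp only [Function.comp_apply, _root_.zero_apply]
    rw [← h, map_sub, hzero n _ (posPart_nonneg _) (by rw [← h']; simp [negPart_nonneg]),
      hzero n _ (negPart_nonneg _) (by rw [← h']; simp [posPart_nonneg]), sub_zero]
  exact DFunLike.coe_injective heq

end NonsupportPoints

/-! ### The generating space as a Banach lattice with unit -/

namespace GeneratingSpace

variable {X : Type v} [NormedAddCommGroup X] [NormedSpace ℝ X] [Lattice X] [IsBanachLattice X]
  {u : X} {hu : u ∈ positiveCone X}

theorem incl_unit : incl u hu (unit u hu) = u := rfl

theorem incl_sup (x y : GeneratingSpace u hu) : incl u hu (x ⊔ y) = incl u hu x ⊔ incl u hu y := rfl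

theorem incl_abs (x : GeneratingSpace u hu) : incl u hu |x| = |incl u hu x| := by
  rw [abs, incl_sup, map_neg, abs]

theorem mem_bounds_iff {x : GeneratingSpace u hu} {r : ℝ} :
    r ∈ bounds x ↔ 0 < r ∧ |incl u hu x| ≤ r • u := by
  rw [abs_le', neg_le, and_comm (a := incl u hu x ≤ _)]
  exact Iff.rfl

/-- The infimum may be used as a bound because the cone of `X` is closed: let `t` decrease to `r`.
-/
theorem norm_le_iff {x : GeneratingSpace u hu} {r : ℝ} (hr : 0 < r) :
    ‖x‖ ≤ r ↔ |incl u hu x| ≤ r • u := by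
  refine ⟨fun h => ?_, fun h => unorm_le_of_mem (mem_bounds_iff.2 ⟨hr, h⟩)⟩
  have hcont : Continuous fun t : ℝ => t • u := continuous_id.smul continuous_const
  refine ge_of_tendsto (hcont.continuousWithinAt (s := Set.Ioi r) (x := r)) ?_
  filter_upwards [self_mem_nhdsWithin] with t ht
  exact (mem_bounds_iff.1 (mem_of_unorm_lt (lt_of_le_of_lt h ht))).2

instance : IsOrderedAddMonoid (GeneratingSpace u hu) where
  add_le_add_left x y h z := by
    rw [← incl_le_incl] at h ⊢
    rw [map_add, map_add]
    gcongr

instance : IsOrderedModule ℝ (GeneratingSpace u hu) where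
  smul_le_smul_of_nonneg_left t ht x y h := by
    rw [← incl_le_incl] at h ⊢
    rw [map_smul, map_smul]
    exact smul_le_smul_of_nonneg_left h ht
  smul_le_smul_of_nonneg_right x hx s t h := by
    rw [← incl_le_incl] at hx ⊢
    rw [map_smul, map_smul]
    rw [map_zero] at hx
    exact smul_le_smul_of_nonneg_right h hx

instance : HasSolidNorm (GeneratingSpace u hu) where
  solid x y h := by
    refine csInf_le_csInf (bounds_bddBelow x) (bounds_nonempty y) fun r hr => ?_
    rw [← incl_le_incl, incl_abs, incl_abs] at h
    rw [mem_bounds_iff] at hr ⊢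
    exact ⟨hr.1, h.trans hr.2⟩

theorem norm_incl_le (x : GeneratingSpace u hu) : ‖incl u hu x‖ ≤ ‖u‖ * ‖x‖ := by
  have hb : ∀ r : ℝ, ‖x‖ < r → ‖incl u hu x‖ ≤ ‖u‖ * r := by
    intro r hr
    have hr0 : 0 < r := (norm_nonneg x).trans_lt hr
    have h0 : (0 : X) ≤ r • u := smul_nonneg hr0.le hu
    have h := norm_le_norm_of_abs_le_abs
      (((norm_le_iff hr0).1 hr.le).trans_eq (abs_of_nonneg h0).symm)
    rwa [norm_smul, Real.norm_of_nonneg hr0.le, mul_comm] at h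
  have hcont : Continuous fun t : ℝ => ‖u‖ * t := by fun_prop
  refine ge_of_tendsto (hcont.continuousWithinAt (s := Set.Ioi ‖x‖) (x := ‖x‖)) ?_
  filter_upwards [self_mem_nhdsWithin] with t ht using hb t ht

theorem uniformContinuous_incl : UniformContinuous (incl u hu) :=
  ((incl u hu).mkContinuous ‖u‖ norm_incl_le).uniformContinuous

instance : CompleteSpace (GeneratingSpace u hu) := by
  refine Metric.complete_of_cauchySeq_tendsto fun s hs => ?_
  obtain ⟨x, hx⟩ := cauchySeq_tendsto_of_complete (uniformContinuous_incl.comp_cauchySeq hs)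
  have hlim : ∀ ε : ℝ, 0 < ε → ∃ N, ∀ n ≥ N, |incl u hu (s n) - x| ≤ ε • u := by
    intro ε hε
    obtain ⟨N, hN⟩ := Metric.cauchySeq_iff.1 hs ε hε
    refine ⟨N, fun n hn => ?_⟩
    -- Fix `n` and let `m → ∞` in the Cauchy estimate; its order form survives the limit in `X`.
    have ht : Filter.Tendsto (fun m => |incl u hu (s n) - incl u hu (s m)|) Filter.atTop
        (nhds |incl u hu (s n) - x|) := by
      have hc : Continuous fun y : X => |y| := continuous_id.sup continuous_neg
      exact (hc.tendsto _).comp (tendsto_const_nhds.sub hx)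
    refine le_of_tendsto ht ?_
    filter_upwards [Filter.eventually_ge_atTop N] with m hm
    have h := (hN n hn m hm).le
    rwa [dist_eq_norm, norm_le_iff hε, map_sub] at h
  have hmem : x ∈ generatingSubspace (positiveCone X) convex_positiveCone u hu := by
    obtain ⟨N, hN⟩ := hlim 1 one_pos
    have h1 : incl u hu (s N) - x ∈
        generatingSubspace (positiveCone X) convex_positiveCone u hu := by
      rw [mem_iff]
      have h := abs_le'.1 (hN N le_rfl)
      exact ⟨1, one_pos, neg_le.1 h.2, h.1⟩
    have h2 := Submodule.sub_mem _ (s N).2 h1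
    rwa [show (s N).1 - (incl u hu (s N) - x) = x from sub_sub_cancel _ _] at h2
  obtain ⟨y, rfl⟩ : ∃ y : GeneratingSpace u hu, incl u hu y = x := ⟨⟨x, hmem⟩, rfl⟩
  refine ⟨y, Metric.tendsto_atTop.2 fun ε hε => ?_⟩
  obtain ⟨N, hN⟩ := hlim (ε / 2) (half_pos hε)
  refine ⟨N, fun n hn => ?_⟩
  rw [dist_eq_norm]
  refine lt_of_le_of_lt ((norm_le_iff (half_pos hε)).2 ?_) (half_lt_self hε)
  rw [map_sub]
  exact hN n hn

instance : IsBanachLattice (GeneratingSpace u hu) where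

theorem isLatticeUnit_unit : IsLatticeUnit (unit u hu) where
  nonneg := hu
  dominates x := by
    obtain ⟨r, hr⟩ := bounds_nonempty x
    rw [mem_bounds_iff] at hr
    refine ⟨r, hr.1, ?_⟩
    rw [← incl_le_incl, incl_abs, map_smul, incl_unit]
    exact hr.2
  closedBall_eq := by
    ext x
    rw [mem_closedBall_zero_iff, norm_le_iff one_pos, one_smul, abs_le', neg_le, and_comm]
    rfl

end GeneratingSpace

/-! ### Kakutani's representation theorem -/

section Kakutani

variable {E : Type v} [NormedAddCommGroup E] [NormedSpace ℝ E] [Lattice E] {e : E}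

/-- The states of `E` with respect to `e`: the positive functionals with value `1` at `e`. -/
def latticeStates (e : E) : Set (WeakDual ℝ E) := {φ | φ e = 1 ∧ ∀ x, 0 ≤ x → 0 ≤ φ x}

theorem isClosed_latticeStates : IsClosed (latticeStates e) := by
  rw [latticeStates, Set.ofPred_and]
  refine (isClosed_eq (WeakDual.eval_continuous e) continuous_const).inter ?_
  simp only [Set.ofPred_forall]
  exact isClosed_iInter fun x => isClosed_iInter fun _ =>
    isClosed_le continuous_const (WeakDual.eval_continuous x)

/-- The states that are lattice homomorphisms. -/
def latticeCharacters (e : E) : Set (WeakDual ℝ E) :=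
  {φ | φ ∈ latticeStates e ∧ ∀ x, φ x⁺ = (φ x)⁺}

/-- Evaluation, as a linear map from `E` to the continuous functions on its characters. -/
noncomputable def latticeEval (e : E) : E →ₗ[ℝ] C(latticeCharacters e, ℝ) where
  toFun x := ⟨fun φ => φ.1 x, (WeakDual.eval_continuous x).comp continuous_subtype_val⟩
  map_add' x y := by ext φ; exact map_add φ.1 x y
  map_smul' c x := by ext φ; exact map_smul φ.1 c x

theorem latticeEval_apply (x : E) (φ : latticeCharacters e) : latticeEval e x φ = φ.1 x := rfl

theorem latticeEval_posPart (x : E) : latticeEval e x⁺ = latticeEval e x ⊔ 0 := by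
  ext φ
  exact φ.2.2 x

variable [IsBanachLattice E]

namespace IsLatticeUnit

theorem norm_le_iff (he : IsLatticeUnit e) {x : E} {r : ℝ} (hr : 0 < r) :
    ‖x‖ ≤ r ↔ |x| ≤ r • e := by
  have h : r⁻¹ • x ∈ Metric.closedBall (0 : E) 1 ↔ r⁻¹ • x ∈ Set.Icc (-e) e := by
    rw [he.closedBall_eq]
  rw [mem_closedBall_zero_iff, norm_smul, norm_inv, Real.norm_of_nonneg hr.le,
    inv_mul_le_one₀ hr, Set.mem_Icc] at h
  rw [h, abs_le', le_inv_smul_iff_of_pos hr, inv_smul_le_iff_of_pos hr, smul_neg, neg_le, and_comm]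

theorem norm_le_one (he : IsLatticeUnit e) : ‖e‖ ≤ 1 := by
  rw [he.norm_le_iff one_pos, one_smul, abs_of_nonneg he.nonneg]

theorem abs_le_norm_smul (he : IsLatticeUnit e) (x : E) : |x| ≤ ‖x‖ • e := by
  have hcont : Continuous fun t : ℝ => t • e := continuous_id.smul continuous_const
  refine ge_of_tendsto (hcont.continuousWithinAt (s := Set.Ioi ‖x‖) (x := ‖x‖)) ?_
  filter_upwards [self_mem_nhdsWithin] with t ht
  exact (he.norm_le_iff ((norm_nonneg x).trans_lt ht)).1 (le_of_lt ht)

/-- Makes any functional of norm at most one that norms `x + e` also norm `x` and take the value `1`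
at `e`. The condition `x ≠ 0` excludes the trivial space, where `‖e‖ = 0`. -/
theorem norm_add_unit (he : IsLatticeUnit e) {x : E} (hx : 0 ≤ x) (hx0 : x ≠ 0) :
    ‖x + e‖ = ‖x‖ + 1 := by
  refine le_antisymm ((norm_add_le x e).trans (add_le_add le_rfl he.norm_le_one)) ?_
  have h := he.abs_le_norm_smul (x + e)
  rw [abs_of_nonneg (add_nonneg hx he.nonneg), ← le_sub_iff_add_le] at h
  have h1 : x ≤ (‖x + e‖ - 1) • e := by rwa [sub_smul, one_smul]
  have hpos : 0 < ‖x + e‖ - 1 := by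
    by_contra! hneg
    exact hx0 (le_antisymm (h1.trans (smul_nonpos_of_nonpos_of_nonneg hneg he.nonneg)) hx)
  have h2 := (he.norm_le_iff hpos).2 (by rwa [abs_of_nonneg hx])
  linarith

end IsLatticeUnit

theorem abs_apply_le_of_mem_latticeStates {φ : WeakDual ℝ E} (hφ : φ ∈ latticeStates e) (x : E) :
    |φ x| ≤ φ |x| := by
  have h1 := hφ.2 _ (sub_nonneg.2 (le_abs_self x))
  have h2 := hφ.2 _ (sub_nonneg.2 (neg_le_abs x))
  rw [map_sub] at h1 h2
  rw [map_neg] at h2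
  exact abs_le'.2 ⟨by linarith, by linarith⟩

theorem apply_mono_of_mem_latticeStates {φ : WeakDual ℝ E} (hφ : φ ∈ latticeStates e) {x y : E}
    (h : x ≤ y) : φ x ≤ φ y := by
  have := hφ.2 _ (sub_nonneg.2 h)
  rw [map_sub] at this
  linarith

theorem abs_apply_le_norm_of_mem_latticeStates (he : IsLatticeUnit e) {φ : WeakDual ℝ E}
    (hφ : φ ∈ latticeStates e) (x : E) : |φ x| ≤ ‖x‖ := by
  refine (abs_apply_le_of_mem_latticeStates hφ x).trans ?_
  have h := apply_mono_of_mem_latticeStates hφ (he.abs_le_norm_smul x)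
  rwa [map_smul, hφ.1, smul_eq_mul, mul_one] at h

theorem isCompact_latticeStates (he : IsLatticeUnit e) : IsCompact (latticeStates e) := by
  refine (WeakDual.isCompact_closedBall (0 : StrongDual ℝ E) 1).of_isClosed_subset
    isClosed_latticeStates fun φ hφ => ?_
  rw [Set.mem_preimage, mem_closedBall_zero_iff]
  refine ContinuousLinearMap.opNorm_le_bound _ zero_le_one fun x => ?_
  rw [one_mul]
  exact abs_apply_le_norm_of_mem_latticeStates he hφ x

theorem exists_latticeState_apply_eq_norm (he : IsLatticeUnit e) {x : E} (hx : 0 ≤ x)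
    (hx0 : x ≠ 0) : ∃ φ ∈ latticeStates e, φ x = ‖x‖ := by
  obtain ⟨g, hg, hgx⟩ := exists_dual_vector'' ℝ (x + e)
  have hle : ∀ y, g y ≤ ‖y‖ := fun y =>
    (le_abs_self _).trans ((g.le_opNorm y).trans (mul_le_of_le_one_left (norm_nonneg y) hg))
  rw [he.norm_add_unit hx hx0, map_add] at hgx
  have h1 := hle x
  have h2 := (hle e).trans he.norm_le_one
  have hge : g e = 1 := by
    simp only [RCLike.ofReal_real_eq_id, id_eq] at hgx
    linarith
  refine ⟨StrongDual.toWeakDual g, ⟨hge, fun y hy => ?_⟩, ?_⟩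
  · change 0 ≤ g y
    rcases eq_or_ne y 0 with rfl | hy0
    · rw [map_zero]
    have hpos : 0 < ‖y‖ := norm_pos_iff.2 hy0
    -- Positivity follows from `‖g‖ ≤ 1` and `g e = 1`, since `‖y‖ - g y = g (‖y‖ • e - y) ≤ ‖y‖`.
    have h3 : ‖‖y‖ • e - y‖ ≤ ‖y‖ := by
      rw [he.norm_le_iff hpos, abs_of_nonneg]
      · exact sub_le_self _ hy
      · exact sub_nonneg.2 ((le_abs_self y).trans (he.abs_le_norm_smul y))
    have h4 := (hle _).trans h3
    rw [map_sub, map_smul, hge, smul_eq_mul, mul_one] at h4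
    linarith
  · change g x = ‖x‖
    simp only [RCLike.ofReal_real_eq_id, id_eq] at hgx
    linarith

/-- An extreme state is proportional to every positive functional that it dominates. -/
theorem eq_smul_of_mem_extremePoints_latticeStates (he : IsLatticeUnit e) {φ ψ : WeakDual ℝ E}
    (hφ : φ ∈ (latticeStates e).extremePoints ℝ) (hψ : ∀ x, 0 ≤ x → 0 ≤ ψ x)
    (hψφ : ∀ x, 0 ≤ x → ψ x ≤ φ x) : ψ = ψ e • φ := by
  have hzero : ∀ χ : WeakDual ℝ E, (∀ x, 0 ≤ x → 0 ≤ χ x) → χ e = 0 → χ = 0 := by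
    intro χ hχ hχe
    refine DFunLike.ext _ _ fun x => ?_
    have h1 := hχ _ (sub_nonneg.2 ((le_abs_self x).trans (he.abs_le_norm_smul x)))
    have h2 := hχ _ (sub_nonneg.2 ((neg_le_abs x).trans (he.abs_le_norm_smul x)))
    rw [map_sub, map_smul, hχe, smul_zero] at h1 h2
    rw [map_neg] at h2
    change χ x = 0
    linarith
  have hφ1 := hφ.1.1
  have hdiff : ∀ x, 0 ≤ x → 0 ≤ (φ - ψ) x := fun x hx => sub_nonneg.2 (hψφ x hx)
  have hde : (φ - ψ) e = 1 - ψ e := congrArg (· - ψ e) hφ1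
  rcases (hψ e he.nonneg).eq_or_lt with h0 | h0
  · rw [← h0, zero_smul]
    exact hzero ψ hψ h0.symm
  rcases (hdiff e he.nonneg).eq_or_lt with h1 | h1
  · have h2 := sub_eq_zero.1 (hzero _ hdiff h1.symm)
    rw [← h2, hφ1, one_smul]
  -- Normalizing `ψ` and `φ - ψ` writes `φ` as a proper convex combination of two states.
  have hA : (ψ e)⁻¹ • ψ ∈ latticeStates e :=
    ⟨inv_mul_cancel₀ h0.ne', fun x hx => mul_nonneg (inv_pos.2 h0).le (hψ x hx)⟩
  have hB : ((φ - ψ) e)⁻¹ • (φ - ψ) ∈ latticeStates e :=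
    ⟨inv_mul_cancel₀ h1.ne', fun x hx => mul_nonneg (inv_pos.2 h1).le (hdiff x hx)⟩
  have hseg := hφ.2 hA hB ⟨ψ e, (φ - ψ) e, h0, h1, by rw [hde]; ring, by
    rw [smul_smul, smul_smul, mul_inv_cancel₀ h0.ne', mul_inv_cancel₀ h1.ne', one_smul, one_smul,
      add_sub_cancel]⟩
  rw [← hseg]
  change ψ = ψ e • _
  conv_rhs => rw [smul_smul, mul_inv_cancel₀ h0.ne', one_smul]

/-- For a positive functional `φ` and a vector `a` there is a functional between `0` and `φ` whose
value at `a` is `φ a⁺`. -/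
theorem exists_between_apply_eq_apply_posPart (he : IsLatticeUnit e) {φ : WeakDual ℝ E}
    (hφ : φ ∈ latticeStates e) (a : E) :
    ∃ ψ : WeakDual ℝ E, (∀ x, 0 ≤ x → 0 ≤ ψ x) ∧ (∀ x, 0 ≤ x → ψ x ≤ φ x) ∧ ψ a = φ a⁺ := by
  rcases eq_or_ne a 0 with rfl | ha
  · exact ⟨0, fun _ _ => le_rfl, fun x hx => hφ.2 x hx, by simp⟩
  have hpos : ∀ x : E, 0 ≤ φ x⁺ := fun x => hφ.2 _ (posPart_nonneg x)
  have hsmul : ∀ (c : ℝ) (_ : 0 ≤ c) (x : E), (c • x)⁺ = c • x⁺ := by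
    intro c hc x
    rcases hc.eq_or_lt with rfl | hc
    · simp
    refine le_antisymm ?_ ?_
    · rw [posPart_def]
      exact sup_le (smul_le_smul_of_nonneg_left (le_posPart x) hc.le)
        (smul_nonneg hc.le (posPart_nonneg x))
    · rw [← le_inv_smul_iff_of_pos hc, posPart_def]
      exact sup_le ((le_inv_smul_iff_of_pos hc).2 (le_posPart _))
        (smul_nonneg (inv_pos.2 hc).le (posPart_nonneg _))
  -- Hahn-Banach with the sublinear majorant `x ↦ φ x⁺`, starting from the line through `a`. The
  -- majorant vanishes at `-x` for `x ≥ 0`, which makes the extension positive.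
  obtain ⟨g, hga, hgle⟩ := exists_extension_of_le_sublinear
    (LinearPMap.mkSpanSingleton a (φ a⁺) ha) (fun x => φ x⁺)
    (fun c hc x => by rw [hsmul c hc.le, map_smul, smul_eq_mul])
    (fun x y => by
      rw [← map_add]
      refine apply_mono_of_mem_latticeStates hφ ?_
      rw [posPart_def (x + y)]
      exact sup_le (add_le_add (le_posPart x) (le_posPart y))
        (add_nonneg (posPart_nonneg x) (posPart_nonneg y)))
    (by
      rintro ⟨y, hy⟩
      obtain ⟨c, rfl⟩ := Submodule.mem_span_singleton.1 hy
      rw [LinearPMap.mkSpanSingleton'_apply]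
      rcases le_total 0 c with hc | hc
      · rw [hsmul c hc, map_smul]
        rfl
      · exact (mul_nonpos_of_nonpos_of_nonneg hc (hpos a)).trans (hpos _))
  have hnn : ∀ x, 0 ≤ x → 0 ≤ g x := fun x hx => by
    have h := hgle (-x)
    rw [posPart_of_nonpos (neg_nonpos.2 hx), map_zero, map_neg] at h
    linarith
  have hgφ : ∀ x, 0 ≤ x → g x ≤ φ x := fun x hx => by
    have h := hgle x
    rwa [posPart_of_nonneg hx] at h
  have hbound : ∀ x, ‖g x‖ ≤ 1 * ‖x‖ := by
    have hle : ∀ x, g x ≤ ‖x‖ := fun x =>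
      (hgle x).trans ((apply_mono_of_mem_latticeStates hφ
        (sup_le (le_abs_self x) (abs_nonneg x))).trans ((le_abs_self _).trans ((abs_apply_le_norm_of_mem_latticeStates he hφ |x|).trans_eq
          (norm_abs_eq_norm x))))
    intro x
    rw [one_mul, Real.norm_eq_abs]
    refine abs_le'.2 ⟨hle x, ?_⟩
    simpa using hle (-x)
  refine ⟨StrongDual.toWeakDual (g.mkContinuous 1 hbound), hnn, hgφ, ?_⟩
  have h := hga ⟨a, Submodule.mem_span_singleton_self a⟩
  rwa [LinearPMap.mkSpanSingleton_apply] at h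

theorem apply_posPart_of_mem_extremePoints (he : IsLatticeUnit e) {φ : WeakDual ℝ E}
    (hφ : φ ∈ (latticeStates e).extremePoints ℝ) (a : E) : φ a⁺ = (φ a)⁺ := by
  -- By extremality `φ b⁺ = ψ b = ψ e * φ b`, which is nonpositive when `φ b` is.
  have hle : ∀ b : E, φ b ≤ 0 → φ b⁺ = 0 := by
    intro b hb
    obtain ⟨ψ, h0, h1, hψb⟩ := exists_between_apply_eq_apply_posPart he hφ.1 b
    have h2 := eq_smul_of_mem_extremePoints_latticeStates he hφ h0 h1
    have h3 : ψ b = ψ e * φ b := DFunLike.congr_fun h2 b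
    refine le_antisymm ?_ (hφ.1.2 _ (posPart_nonneg b))
    rw [← hψb, h3]
    exact mul_nonpos_of_nonneg_of_nonpos (h0 e he.nonneg) hb
  rcases le_total (φ a) 0 with h | h
  · rw [posPart_of_nonpos h, hle a h]
  · have h1 := hle (-a) (by rw [map_neg]; linarith)
    rw [posPart_neg] at h1
    rw [posPart_of_nonneg h, ← sub_zero (φ a⁺), ← h1, ← map_sub, posPart_sub_negPart]

theorem isCompact_latticeCharacters (he : IsLatticeUnit e) : IsCompact (latticeCharacters e) := by
  refine (isCompact_latticeStates he).of_isClosed_subset ?_ fun φ hφ => hφ.1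
  rw [latticeCharacters, Set.ofPred_and]
  refine isClosed_latticeStates.inter ?_
  simp only [Set.ofPred_forall]
  exact isClosed_iInter fun x =>
    isClosed_eq (WeakDual.eval_continuous _) (continuous_posPart.comp (WeakDual.eval_continuous x))

theorem exists_latticeCharacter_apply_eq_norm (he : IsLatticeUnit e) {x : E} (hx : 0 ≤ x)
    (hx0 : x ≠ 0) : ∃ φ ∈ latticeCharacters e, φ x = ‖x‖ := by
  -- `F` is a face: every state is at most `‖x‖` at `x`, so `φ x = ‖x‖` forces equality at both ends
  -- of a segment. Its extreme points are thus extreme states.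
  set F : Set (WeakDual ℝ E) := {φ | φ ∈ latticeStates e ∧ φ x = ‖x‖}
  have hFc : IsCompact F := (isCompact_latticeStates he).inter_right
    (isClosed_eq (WeakDual.eval_continuous x) continuous_const)
  have hF : F.Nonempty := exists_latticeState_apply_eq_norm he hx hx0
  have hext : IsExtreme ℝ (latticeStates e) F := by
    refine ⟨fun φ hφ => hφ.1, ?_⟩
    rintro φ₁ h₁ φ₂ h₂ φ hφ ⟨s, t, hs, ht, hst, rfl⟩
    refine ⟨h₁, ?_⟩
    have h3 : s * φ₁ x + t * φ₂ x = ‖x‖ := hφ.2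
    have h4 := (le_abs_self _).trans (abs_apply_le_norm_of_mem_latticeStates he h₁ x)
    have h5 := (le_abs_self _).trans (abs_apply_le_norm_of_mem_latticeStates he h₂ x)
    refine le_antisymm h4 ?_
    by_contra! hlt
    have h6 := mul_lt_mul_of_pos_left hlt hs
    have h7 := mul_le_mul_of_nonneg_left h5 ht.le
    have h8 : s * ‖x‖ + t * ‖x‖ = ‖x‖ := by rw [← add_mul, hst, one_mul]
    linarith
  have : LocallyConvexSpace ℝ (WeakDual ℝ E) :=
    inferInstanceAs (LocallyConvexSpace ℝ (WeakBilin (topDualPairing ℝ E)))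
  obtain ⟨φ, hφ⟩ := hFc.extremePoints_nonempty hF
  exact ⟨φ, ⟨hφ.1.1, apply_posPart_of_mem_extremePoints he
    (hext.extremePoints_subset_extremePoints hφ)⟩, hφ.1.2⟩

theorem latticeEval_sup (x y : E) : latticeEval e (x ⊔ y) = latticeEval e x ⊔ latticeEval e y := by
  have h : x ⊔ y = (x - y)⁺ + y := by rw [posPart_def, sup_add, sub_add_cancel, zero_add]
  rw [h, map_add, latticeEval_posPart, map_sub, sup_add, sub_add_cancel, zero_add]

theorem latticeEval_inf (x y : E) : latticeEval e (x ⊓ y) = latticeEval e x ⊓ latticeEval e y := by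
  have h : x ⊓ y = -(-x ⊔ -y) := by rw [neg_sup, neg_neg, neg_neg]
  rw [h, map_neg, latticeEval_sup, neg_sup, map_neg, map_neg, neg_neg, neg_neg]

theorem norm_latticeEval [CompactSpace (latticeCharacters e)] (he : IsLatticeUnit e) (x : E) :
    ‖latticeEval e x‖ = ‖x‖ := by
  refine le_antisymm ((ContinuousMap.norm_le _ (norm_nonneg x)).2 fun φ =>
    abs_apply_le_norm_of_mem_latticeStates he φ.2.1 x) ?_
  rcases eq_or_ne x 0 with rfl | hx0
  · rw [norm_zero]; exact norm_nonneg _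
  obtain ⟨φ, hφ, hφx⟩ := exists_latticeCharacter_apply_eq_norm he (abs_nonneg x)
    (by rwa [← norm_ne_zero_iff, norm_abs_eq_norm, norm_ne_zero_iff])
  have h : φ |x| = |φ x| := by
    rw [← posPart_add_negPart x, map_add, hφ.2 x, ← posPart_neg, hφ.2 (-x), map_neg, posPart_neg,
      posPart_add_negPart]
  rw [← norm_abs_eq_norm, ← hφx, h]
  exact (latticeEval e x).norm_coe_le_norm ⟨φ, hφ⟩

theorem latticeEval_le_iff [CompactSpace (latticeCharacters e)] (he : IsLatticeUnit e) (x y : E) :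
    latticeEval e x ≤ latticeEval e y ↔ x ≤ y := by
  have hinj : Function.Injective (latticeEval e) := by
    intro x y h
    rw [← sub_eq_zero, ← norm_eq_zero, ← norm_latticeEval he, map_sub, h, sub_self, norm_zero]
  rw [← sup_eq_right, ← latticeEval_sup, hinj.eq_iff, sup_eq_right]

theorem latticeEval_surjective [CompactSpace (latticeCharacters e)] (he : IsLatticeUnit e) :
    Function.Surjective (latticeEval e) := by
  have hiso : Isometry (latticeEval e) :=
    AddMonoidHomClass.isometry_of_norm _ (norm_latticeEval he)
  have hclosed : IsClosed (Set.range (latticeEval e)) := hiso.isClosedEmbedding.isClosed_range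
  have htop := ContinuousMap.sublattice_closure_eq_top (Set.range (latticeEval e))
    (Set.range_nonempty _)
    (by rintro _ ⟨x, rfl⟩ _ ⟨y, rfl⟩; exact ⟨x ⊓ y, latticeEval_inf x y⟩)
    (by rintro _ ⟨x, rfl⟩ _ ⟨y, rfl⟩; exact ⟨x ⊔ y, latticeEval_sup x y⟩)
    -- Two-point interpolation: `e` gives the constants, and distinct characters differ at some `x`.
    (by
      intro v φ ψ
      rcases eq_or_ne φ ψ with rfl | hne
      · refine ⟨_, ⟨v φ • e, rfl⟩, ?_⟩
        rw [latticeEval_apply, map_smul, φ.2.1.1, smul_eq_mul, mul_one]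
        exact ⟨rfl, rfl⟩
      obtain ⟨x, hx⟩ : ∃ x, φ.1 x ≠ ψ.1 x := by
        by_contra! h
        exact hne (Subtype.ext (DFunLike.ext _ _ h))
      have hx' := sub_ne_zero.2 hx
      set c := (v φ - v ψ) / (φ.1 x - ψ.1 x) with hc
      have hcm : c * (φ.1 x - ψ.1 x) = v φ - v ψ := div_mul_cancel₀ _ hx'
      refine ⟨_, ⟨c • x + (v φ - c * φ.1 x) • e, rfl⟩, ?_, ?_⟩
      · rw [latticeEval_apply, map_add, map_smul, map_smul, φ.2.1.1, smul_eq_mul, smul_eq_mul]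
        ring
      · rw [latticeEval_apply, map_add, map_smul, map_smul, ψ.2.1.1, smul_eq_mul, smul_eq_mul]
        linarith)
  rw [hclosed.closure_eq] at htop
  exact Set.range_eq_univ.1 htop

/-- **Kakutani's theorem**: a Banach lattice with unit is order isometric to some `C(K)`. -/
theorem IsLatticeUnit.exists_orderIsometric (he : IsLatticeUnit e) :
    ∃ (K : Type v) (_ : TopologicalSpace K) (_ : CompactSpace K) (_ : T2Space K),
      OrderIsometric E C(K, ℝ) := by
  have hK : CompactSpace (latticeCharacters e) :=
    isCompact_iff_compactSpace.1 (isCompact_latticeCharacters he)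
  refine ⟨latticeCharacters e, inferInstance, hK, inferInstance, ?_⟩
  exact ⟨LinearIsometryEquiv.ofSurjective ⟨latticeEval e, norm_latticeEval he⟩
    (latticeEval_surjective he), latticeEval_le_iff he⟩

end Kakutani

theorem theorem7p9 {X : Type v} [NormedAddCommGroup X] [NormedSpace ℝ X] [Lattice X]
    [IsBanachLattice X] [TopologicalSpace.SeparableSpace X] :
    (nonsupportPoints (positiveCone X)).Nonempty ∧
    ∀ (u : X) (hu : u ∈ nonsupportPoints (positiveCone X)),
      IsBanachLattice (GeneratingSpace u hu.1) ∧
      IsLatticeUnit (GeneratingSpace.unit u hu.1) ∧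
      ∃ (K : Type v) (_ : TopologicalSpace K) (_ : CompactSpace K) (_ : T2Space K),
        OrderIsometric (GeneratingSpace u hu.1) C(K, ℝ) :=
  ⟨nonsupportPoints_positiveCone_nonempty, fun _ _ => ⟨inferInstance,
    GeneratingSpace.isLatticeUnit_unit, GeneratingSpace.isLatticeUnit_unit.exists_orderIsometric⟩⟩
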